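/- Let $\mathbb{H}^2=\{z\in\mathbb{C}:\operatorname{Im} z>0\}$ be the hyperbolic plane with its distance $d$ and base point $o=i$, let $\partial\mathbb{H}^2=\mathbb{R}\cup\{\infty\}$, and let $D$ be the visual metric on $\partial\mathbb{H}^2$ seen from $o$, that is, half the chordal distance on the unit circle after the Cayley transform $z\mapsto (z-i)/(z+i)$. For $G\le \mathrm{SL}_2(\mathbb{R})$ acting by Möbius transformations, let $\Lambda$ be the limit set of $G$, i.e. the set of the limits in $\partial\mathbb{H}^2$ of sequences in $G(o)$. For $\sigma>0$ let $\Lambda_{r,\sigma}$ be the set of those $\eta\in\partial\mathbb{H}^2$ for which there are $g_n\in G$ with $g_n(o)\to\eta$ and $\langle o|\eta\rangle_{g_n(o)}\le\sigma$ for all $n$, where $\langle\cdot|\cdot\rangle$ is the Gromov product (extended to boundary points by a lower limit), and let $\Lambda_r=\bigcup_{\sigma>0}\Lambda_{r,\sigma}$ be the radial limit set. Let $\delta=\inf\{s\ge 0:\sum_{g\in G}e^{-s\,d(o,g(o))}<\infty\}$ be the Poincaré exponent of $G$. For $\xi\in\partial\mathbb{H}^2$ put $$\omega_\xi(\eta)=\limsup_{g\in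 G,\ d(o,g(o))\to\infty}\frac{-\log D(g(\xi),\eta)}{d(o,g(o))},\qquad \mathrm{VWA}_\xi=\{\eta\in\Lambda_r:\omega_\xi(\eta)>1\},$$ with $\log 0=-\infty$, and $$P_\xi(s)=\lim_{\sigma\to\infty}\liminf_{r\to0^+}\frac{\log \mathcal{H}^s_\infty\big(B(\xi,r)\cap\Lambda_{r,\sigma}\big)}{\log r},$$ where $\mathcal{H}^s_\infty(S)=\inf\sum_{A\in\mathcal{C}}\operatorname{diam}(A)^s$, over all countable covers $\mathcal{C}$ of $S$, is the Hausdorff content in dimension $s$, and where closed balls $B(\xi,r)$ and diameters are taken in the metric $D$. **Proposition.** There exist a discrete subgroup $G$ of $\mathrm{SL}_2(\mathbb{R})$ (a Fuchsian group) and a point $\xi\in\Lambda$ with the following properties. 1. $G$ is nonelementary, i.e. $\Lambda$ has at least three points. 2. $G$ is an infinitely generated Schottky group: $G$ is not finitely generated, and it is generated by elements $g_0,g_1,\dots$ for which there are closed discs $D_n,D_n'$ $(n\ge 0)$ of positive radius centred on the real line, all pairwise disjoint, such that $g_n(\mathbb{H}^2\setminus D_n)=\mathbb{H}^2\cap\operatorname{int}D_n'$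 for every $n$. 3. The Hausdorff dimension of $\mathrm{VWA}_\xi$ is $0$. 4. $P_\xi(s)=+\infty$ for all $s\in(0,\delta)$. -/

import Mathlib

open scoped UpperHalfPlane MatrixGroups ENNReal NNReal Topology

noncomputable section

namespace FuchsianApprox

/-- The Cayley transform, the isometry of the upper half-plane model onto the disc model of the
hyperbolic plane that sends the base point `i` to `0`. -/
def cayley (z : ℂ) : ℂ := (z - Complex.I) / (z + Complex.I)

/-- The boundary of the upper half-plane is `ℝ ∪ {∞}`, that is `OnePoint ℝ`. This is the extension
of the Cayley transform to the boundary; it identifies the boundary with the unit circle. -/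
def circlePt : OnePoint ℝ → ℂ
  | none => 1
  | some x => cayley (x : ℂ)

/-- The visual metric on the boundary, seen from the base point `i` with parameter `e`:
half the chordal distance on the unit circle. -/
def visualDist (ξ η : OnePoint ℝ) : ℝ := dist (circlePt ξ) (circlePt η) / 2

/-- The action of `SL(2, ℝ)` on the boundary by Möbius transformations. -/
def bdryAct (g : SL(2, ℝ)) (ξ : OnePoint ℝ) : OnePoint ℝ := (g : GL (Fin 2) ℝ) • ξ

/-- The displacement `d(i, g(i))` of the base point. -/
def displacement (g : SL(2, ℝ)) : ℝ := dist UpperHalfPlane.I (g • UpperHalfPlane.I)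

/-- The filter of points of the hyperbolic plane that approach a given boundary point, for the
topology of the closed disc. -/
def approach (η : OnePoint ℝ) : Filter ℍ :=
  Filter.comap (fun z : ℍ => cayley (z : ℂ)) (𝓝 (circlePt η))

/-- The Gromov product `⟨x|y⟩_z`. -/
def gromovProduct (x y z : ℍ) : ℝ := (dist x z + dist y z - dist x y) / 2

/-- The Gromov product `⟨x|η⟩_z` with a boundary point `η`. -/
def gromovProductBdry (x : ℍ) (η : OnePoint ℝ) (z : ℍ) : ℝ :=
  Filter.liminf (fun y : ℍ => gromovProduct x y z) (approach η)

/-- The shadow of size `σ` cast by `x`, seen from the base point `i`. -/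
def shadow (x : ℍ) (σ : ℝ) : Set (OnePoint ℝ) :=
  {η | gromovProductBdry UpperHalfPlane.I η x ≤ σ}

/-- The limit set of `G`. -/
def limitSet (G : Subgroup SL(2, ℝ)) : Set (OnePoint ℝ) :=
  {η | ∃ g : ℕ → SL(2, ℝ), (∀ n, g n ∈ G) ∧
    Filter.Tendsto (fun n => g n • UpperHalfPlane.I) Filter.atTop (approach η)}

/-- The `σ`-radial limit set of `G`. -/
def radialLimitSetOf (G : Subgroup SL(2, ℝ)) (σ : ℝ) : Set (OnePoint ℝ) :=
  {η | ∃ g : ℕ → SL(2, ℝ), (∀ n, g n ∈ G) ∧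
    Filter.Tendsto (fun n => g n • UpperHalfPlane.I) Filter.atTop (approach η) ∧
    ∀ n, η ∈ shadow (g n • UpperHalfPlane.I) σ}

/-- The radial limit set of `G`. -/
def radialLimitSet (G : Subgroup SL(2, ℝ)) : Set (OnePoint ℝ) :=
  {η | ∃ σ : ℝ, 0 < σ ∧ η ∈ radialLimitSetOf G σ}

/-- `G` is nonelementary if its limit set has at least three points. -/
def Nonelementary (G : Subgroup SL(2, ℝ)) : Prop := 3 ≤ (limitSet G).encard

/-- The exponent `ω_ξ(η)` of approximation of `η` by the orbit of `ξ`: the limsup of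
`-log D(g(ξ), η) / d(i, g(i))` over `g ∈ G` as `d(i, g(i)) → ∞`, where `log 0 = -∞`. -/
def approxExponent (G : Subgroup SL(2, ℝ)) (ξ η : OnePoint ℝ) : EReal :=
  Filter.limsup
    (fun g : G => -ENNReal.log (ENNReal.ofReal (visualDist (bdryAct g ξ) η)) /
      ((displacement g : ℝ) : EReal))
    (Filter.comap (fun g : G => displacement g) Filter.atTop)

/-- The radial limit points that are very well approximable with respect to `ξ`. -/
def veryWellApproximable (G : Subgroup SL(2, ℝ)) (ξ : OnePoint ℝ) : Set (OnePoint ℝ) :=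
  {η | η ∈ radialLimitSet G ∧ 1 < approxExponent G ξ η}

/-- The Hausdorff dimension of a subset of the boundary. (The factor `1 / 2` of the visual metric
plays no role.) -/
def hausdorffDim (S : Set (OnePoint ℝ)) : ℝ≥0∞ := dimH (circlePt '' S)

/-- The diameter of a subset of the boundary in the visual metric. -/
def visualDiam (S : Set (OnePoint ℝ)) : ℝ≥0∞ := Metric.ediam (circlePt '' S) / 2

/-- The Hausdorff content of `S` in dimension `s`. -/
def hausdorffContent (s : ℝ) (S : Set (OnePoint ℝ)) : ℝ≥0∞ :=
  ⨅ (A : ℕ → Set (OnePoint ℝ)) (_ : S ⊆ ⋃ n, A n), ∑' n, ⨆ _ : (A n).Nonempty, visualDiam (A n) ^ s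

/-- The Poincaré exponent of `G`: the infimum of the `s ≥ 0` at which the Poincaré series
converges. -/
def poincareExponent (G : Subgroup SL(2, ℝ)) : ℝ≥0∞ :=
  ⨅ (s : ℝ≥0) (_ : ∑' g : G, ENNReal.ofReal (Real.exp (-(s : ℝ) * displacement g)) < ∞), (s : ℝ≥0∞)

/-- The Hausdorff content of the part of the `σ`-radial limit set in the closed ball about `ξ` of
radius `r`. -/
def localContent (G : Subgroup SL(2, ℝ)) (ξ : OnePoint ℝ) (σ s r : ℝ) : ℝ≥0∞ :=
  hausdorffContent s ({η | visualDist ξ η ≤ r} ∩ radialLimitSetOf G σ)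

/-- The function `P_ξ(s)`. The inner quotient is nonincreasing in `σ`, so that the outer
`liminf` is a limit. -/
def localDimension (G : Subgroup SL(2, ℝ)) (ξ : OnePoint ℝ) (s : ℝ) : EReal :=
  Filter.liminf
    (fun σ : ℝ => Filter.liminf
      (fun r : ℝ => ENNReal.log (localContent G ξ σ s r) / ((Real.log r : ℝ) : EReal)) (𝓝[>] 0))
    Filter.atTop

/-- `G` is a Schottky group on infinitely many generators `g₀, g₁, …`: there are pairwise disjoint
closed discs `Dₙ`, `Dₙ'` centred on the real line such that `gₙ` maps the part of the upper
half-plane outside `Dₙ` onto its part in the interior of `Dₙ'`. -/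
def IsInfiniteSchottky (G : Subgroup SL(2, ℝ)) : Prop :=
  ∃ (g : ℕ → SL(2, ℝ)) (c c' r r' : ℕ → ℝ),
    G = Subgroup.closure (Set.range g) ∧
    (∀ n, 0 < r n ∧ 0 < r' n) ∧
    (Pairwise fun m n => Disjoint (Metric.closedBall (c m : ℂ) (r m))
      (Metric.closedBall (c n : ℂ) (r n))) ∧
    (Pairwise fun m n => Disjoint (Metric.closedBall (c' m : ℂ) (r' m))
      (Metric.closedBall (c' n : ℂ) (r' n))) ∧
    (∀ m n, Disjoint (Metric.closedBall (c m : ℂ) (r m))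
      (Metric.closedBall (c' n : ℂ) (r' n))) ∧
    ∀ (n : ℕ) (z : ℍ), r n < dist (z : ℂ) (c n : ℂ) ↔ dist ((g n • z : ℍ) : ℂ) (c' n : ℂ) < r' n

end FuchsianApprox

end

noncomputable section

namespace FuchsianApprox

open Complex Filter

/-! Take discs with centres at the nonnegative integers, of radius `2 ^ (-n) / 8` at `2n` and `2n +
1`, and let `ξ` be infinity, the only point where the discs accumulate. Every other limit point lies
in one of the boundary intervals (`exists_mem_boundaryInterval`). Seen from infinity, the `n`-th
pair of intervals is at distance comparable to `1 / n` but has length exponentially small in `n`.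

Content: a ball of radius `r` about infinity meets only intervals with `n` at least of order `1 /
r`. Covering by these intervals bounds the content by any power of `r` (`localContent_le`), so the
local dimension is infinite.

Approximation: let `D(g ξ, η) ≤ exp (-(1 + c) d)` with `d` the displacement of `g`. Since `g⁻¹`
expands by at most `4 exp d`, the point `g⁻¹ η` is within `4 exp (-c d)` of infinity. Unless it is
infinity, it lies in an interval whose index is at least of order `exp (c d)`. Hence `η` lies in the
`g`-image of that interval, of diameter at most `16 exp d` times its radius, which is tiny even
against `exp (-d)`. The Poincaré series converges at exponent `1`
(`tsum_exp_neg_displacement_lt_top`), so Borel–Cantelli kills every Hausdorff measure of positive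
dimension (`hausdorffMeasure_approximable`). The exceptional orbit of infinity is countable.

Freeness, discreteness and the Poincaré series all come from one ping-pong induction along reduced
words, `dist_wordEval_head_le`. -/

/-! ### The Cayley transform in homogeneous coordinates -/

/-- The Cayley transform in homogeneous coordinates. -/
def homCayley (a b : ℂ) : ℂ := (a - I * b) / (a + I * b)

lemma homCayley_smul {t : ℂ} (ht : t ≠ 0) (a b : ℂ) :
    homCayley (t * a) (t * b) = homCayley a b := by
  unfold homCayley
  rw [show t * a - I * (t * b) = t * (a - I * b) by ring,
    show t * a + I * (t * b) = t * (a + I * b) by ring, mul_div_mul_left _ _ ht]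

/-- Homogeneous coordinates of the points of the closed upper half-plane. -/
def IsClosedHalfPlane (a b : ℂ) : Prop := 0 ≤ (a * (starRingEnd ℂ) b).im ∧ (a ≠ 0 ∨ b ≠ 0)

/-- On the closed half-plane the last term lies between `0` and `normSq a + normSq b`, so the Cayley
denominator is comparable to the Euclidean norm of `(a, b)`. -/
lemma normSq_add_I_mul (a b : ℂ) :
    normSq (a + I * b) = normSq a + normSq b + 2 * (a * (starRingEnd ℂ) b).im := by
  simp [normSq_apply]
  ring

lemma two_mul_im_mul_conj_le (a b : ℂ) :
    2 * (a * (starRingEnd ℂ) b).im ≤ normSq a + normSq b := by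
  simp only [normSq_apply, mul_im, conj_re, conj_im]
  nlinarith [sq_nonneg (a.re + b.im), sq_nonneg (a.im - b.re)]

lemma IsClosedHalfPlane.normSq_pos {a b : ℂ} (h : IsClosedHalfPlane a b) :
    0 < normSq a + normSq b := by
  rcases h.2 with h | h
  · linarith [Complex.normSq_pos.2 h, normSq_nonneg b]
  · linarith [Complex.normSq_pos.2 h, normSq_nonneg a]

lemma IsClosedHalfPlane.ne_zero {a b : ℂ} (h : IsClosedHalfPlane a b) : a + I * b ≠ 0 := by
  rw [← Complex.normSq_pos, normSq_add_I_mul]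
  linarith [h.normSq_pos, h.1]

/-- The numerator is a determinant, hence invariant under `SL(2, ℝ)`; only the denominators distort
the chordal distance. -/
lemma dist_homCayley {a b c d : ℂ} (h : a + I * b ≠ 0) (h' : c + I * d ≠ 0) :
    dist (homCayley a b) (homCayley c d) =
      2 * ‖a * d - b * c‖ / (‖a + I * b‖ * ‖c + I * d‖) := by
  have : homCayley a b - homCayley c d =
      2 * I * (a * d - b * c) / ((a + I * b) * (c + I * d)) := by
    unfold homCayley
    field_simp
    ring
  rw [dist_eq_norm, this]
  simp

lemma coe_det_eq_one (g : SL(2, ℝ)) : g 0 0 * g 1 1 - g 0 1 * g 1 0 = 1 := by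
  rw [← Matrix.det_fin_two, g.det_coe]

lemma coe_smul_eq (g : SL(2, ℝ)) (z : ℍ) :
    ((g • z : ℍ) : ℂ) = (g 0 0 * z + g 0 1) / (g 1 0 * z + g 1 1) := by
  simp [UpperHalfPlane.coe_specialLinearGroup_apply]

lemma denominator_ne_zero (g : SL(2, ℝ)) (z : ℍ) : (g 1 0 * z + g 1 1 : ℂ) ≠ 0 := by
  intro h
  have := (g • z).im_pos
  rw [← UpperHalfPlane.coe_im, coe_smul_eq, h] at this
  simp at this

lemma im_smul_I (g : SL(2, ℝ)) :
    (g • UpperHalfPlane.I : ℍ).im = 1 / (g 1 0 ^ 2 + g 1 1 ^ 2) := by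
  have hd := coe_det_eq_one g
  rw [← UpperHalfPlane.coe_im, coe_smul_eq]
  simp only [UpperHalfPlane.coe_I, div_im, normSq_apply]
  simp
  rw [← sub_div, hd, one_div]
  congr 1
  ring

lemma two_cosh_displacement (g : SL(2, ℝ)) :
    2 * Real.cosh (displacement g) = g 0 0 ^ 2 + g 0 1 ^ 2 + g 1 0 ^ 2 + g 1 1 ^ 2 := by
  have hd := coe_det_eq_one g
  have hpos : 0 < g 1 0 ^ 2 + g 1 1 ^ 2 := by
    have := (g • UpperHalfPlane.I : ℍ).im_pos
    rw [im_smul_I] at this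
    exact one_div_pos.1 this
  have hne := denominator_ne_zero g UpperHalfPlane.I
  have key : dist ((UpperHalfPlane.I : ℍ) : ℂ) ((g • UpperHalfPlane.I : ℍ) : ℂ) ^ 2 =
      ((g 0 1 + g 1 0) ^ 2 + (g 0 0 - g 1 1) ^ 2) / (g 1 0 ^ 2 + g 1 1 ^ 2) := by
    rw [dist_comm, dist_eq_norm, coe_smul_eq, div_sub' hne, norm_div, div_pow,
      ← normSq_eq_norm_sq, ← normSq_eq_norm_sq]
    simp only [UpperHalfPlane.coe_I, normSq_apply]
    simp
    congr 1 <;> ring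
  rw [displacement, UpperHalfPlane.cosh_dist, key, im_smul_I, UpperHalfPlane.I_im]
  field_simp
  linear_combination -2 * hd

lemma displacement_inv (g : SL(2, ℝ)) : displacement g⁻¹ = displacement g := by
  rw [displacement, displacement, ← dist_smul g, smul_inv_smul, dist_comm]

lemma displacement_nonneg (g : SL(2, ℝ)) : 0 ≤ displacement g := dist_nonneg

lemma exp_neg_displacement_le (g : SL(2, ℝ)) :
    Real.exp (-displacement g) ≤ (g • UpperHalfPlane.I : ℍ).im := by
  have := UpperHalfPlane.im_div_exp_dist_le UpperHalfPlane.I (g • UpperHalfPlane.I)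
  rwa [UpperHalfPlane.I_im, one_div, ← Real.exp_neg] at this

lemma isClosedHalfPlane_apply (g : SL(2, ℝ)) {a b : ℂ} (h : IsClosedHalfPlane a b) :
    IsClosedHalfPlane (g 0 0 * a + g 0 1 * b) (g 1 0 * a + g 1 1 * b) := by
  have hd := coe_det_eq_one g
  have hd' : (g 0 0 * g 1 1 - g 0 1 * g 1 0 : ℂ) = 1 := by exact_mod_cast hd
  refine ⟨?_, ?_⟩
  · have := h.1
    have e : ((g 0 0 * a + g 0 1 * b) * (starRingEnd ℂ) (g 1 0 * a + g 1 1 * b)).im =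
        (g 0 0 * g 1 1 - g 0 1 * g 1 0) * (a * (starRingEnd ℂ) b).im := by
      simp
      ring
    rw [e, hd, one_mul]
    exact this
  · by_contra! hc
    rcases h.2 with h | h <;> apply h
    · linear_combination (g 1 1 : ℂ) * hc.1 - (g 0 1 : ℂ) * hc.2 - a * hd'
    · linear_combination (g 0 0 : ℂ) * hc.2 - (g 1 0 : ℂ) * hc.1 - b * hd'

lemma normSq_linear_comb_le (p q : ℝ) (a b : ℂ) :
    normSq (p * a + q * b) ≤ (p ^ 2 + q ^ 2) * (normSq a + normSq b) := by
  simp [normSq_apply]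
  nlinarith [sq_nonneg (p * b.re - q * a.re), sq_nonneg (p * b.im - q * a.im)]

/-- Recover `(a, b)` through the inverse matrix, whose squared Frobenius norm is `2 cosh d ≤ 2 exp
d`; the other factor `2` bounds the cross term of `normSq_add_I_mul`. -/
lemma norm_add_I_mul_le (g : SL(2, ℝ)) {a b : ℂ} (h : IsClosedHalfPlane a b) :
    ‖a + I * b‖ ^ 2 ≤ 4 * Real.exp (displacement g) *
      ‖(g 0 0 * a + g 0 1 * b) + I * (g 1 0 * a + g 1 1 * b)‖ ^ 2 := by
  have hd := coe_det_eq_one g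
  have hd' : (g 0 0 * g 1 1 - g 0 1 * g 1 0 : ℂ) = 1 := by exact_mod_cast hd
  have h' := isClosedHalfPlane_apply g h
  set a' : ℂ := g 0 0 * a + g 0 1 * b with ha'
  set b' : ℂ := g 1 0 * a + g 1 1 * b with hb'
  have ea : a = (g 1 1 : ℝ) * a' + (-g 0 1 : ℝ) * b' := by
    push_cast
    rw [ha', hb']
    linear_combination -a * hd'
  have eb : b = (-g 1 0 : ℝ) * a' + (g 0 0 : ℝ) * b' := by
    push_cast
    rw [ha', hb']
    linear_combination -b * hd'
  have h1 := normSq_linear_comb_le (g 1 1) (-g 0 1) a' b'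
  have h2 := normSq_linear_comb_le (-g 1 0) (g 0 0) a' b'
  rw [← ea] at h1
  rw [← eb] at h2
  have hcosh : Real.cosh (displacement g) ≤ Real.exp (displacement g) := by
    rw [Real.cosh_eq]
    have := Real.exp_le_exp.2 (neg_le_self (displacement_nonneg g))
    linarith
  have hc := two_cosh_displacement g
  rw [← normSq_eq_norm_sq, ← normSq_eq_norm_sq, normSq_add_I_mul a' b', normSq_add_I_mul a b]
  have h3 := two_mul_im_mul_conj_le a b
  have h4 := h'.1
  have h5 := h'.normSq_pos
  have h6 := Real.exp_pos (displacement g)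
  calc normSq a + normSq b + 2 * (a * (starRingEnd ℂ) b).im
      ≤ 2 * (normSq a + normSq b) := by linarith
    _ ≤ 2 * (2 * Real.cosh (displacement g)) * (normSq a' + normSq b') := by
        rw [hc]; linarith
    _ ≤ 4 * Real.exp (displacement g) * (normSq a' + normSq b') := by
        nlinarith
    _ ≤ _ := by
        have : 0 ≤ 4 * Real.exp (displacement g) * (2 * (a' * (starRingEnd ℂ) b').im) := by
          positivity
        linarith

lemma dist_homCayley_apply_le (g : SL(2, ℝ)) {a b c d : ℂ} (h : IsClosedHalfPlane a b)
    (h' : IsClosedHalfPlane c d) :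
    dist (homCayley (g 0 0 * a + g 0 1 * b) (g 1 0 * a + g 1 1 * b))
        (homCayley (g 0 0 * c + g 0 1 * d) (g 1 0 * c + g 1 1 * d)) ≤
      4 * Real.exp (displacement g) * dist (homCayley a b) (homCayley c d) := by
  have hd' : (g 0 0 * g 1 1 - g 0 1 * g 1 0 : ℂ) = 1 := by exact_mod_cast coe_det_eq_one g
  have h1 := norm_add_I_mul_le g h
  have h2 := norm_add_I_mul_le g h'
  have n1 := (isClosedHalfPlane_apply g h).ne_zero
  have n2 := (isClosedHalfPlane_apply g h').ne_zero
  rw [dist_homCayley n1 n2, dist_homCayley h.ne_zero h'.ne_zero]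
  have e : (g 0 0 * a + g 0 1 * b) * (g 1 0 * c + g 1 1 * d) -
      (g 1 0 * a + g 1 1 * b) * (g 0 0 * c + g 0 1 * d) = a * d - b * c := by
    linear_combination (a * d - b * c) * hd'
  rw [e]
  have p1 := norm_pos_iff.2 n1
  have p2 := norm_pos_iff.2 n2
  have p3 := norm_pos_iff.2 h.ne_zero
  have p4 := norm_pos_iff.2 h'.ne_zero
  set K := 4 * Real.exp (displacement g) with hK
  have hKpos : 0 < K := by positivity
  have hprod : ‖a + I * b‖ * ‖c + I * d‖ ≤
      K * (‖(g 0 0 * a + g 0 1 * b) + I * (g 1 0 * a + g 1 1 * b)‖ *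
        ‖(g 0 0 * c + g 0 1 * d) + I * (g 1 0 * c + g 1 1 * d)‖) := by
    refine (sq_le_sq₀ (by positivity) (by positivity)).1 ?_
    calc _ = ‖a + I * b‖ ^ 2 * ‖c + I * d‖ ^ 2 := by ring
      _ ≤ (K * _) * (K * _) := mul_le_mul h1 h2 (by positivity) (by positivity)
      _ = _ := by ring
  rw [← mul_div_assoc, div_le_div_iff₀ (by positivity) (by positivity)]
  nlinarith [mul_le_mul_of_nonneg_left hprod (norm_nonneg (a * d - b * c))]

/-! ### Points of the half-plane and of its boundary -/

lemma cayley_eq_homCayley (z : ℂ) : cayley z = homCayley z 1 := by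
  simp [cayley, homCayley]

lemma isClosedHalfPlane_coe (z : ℍ) : IsClosedHalfPlane z 1 :=
  ⟨by simpa using z.im_pos.le, Or.inr one_ne_zero⟩

lemma cayley_smul (g : SL(2, ℝ)) (z : ℍ) :
    cayley (g • z : ℍ) = homCayley (g 0 0 * z + g 0 1 * 1) (g 1 0 * z + g 1 1 * 1) := by
  have h := denominator_ne_zero g z
  rw [cayley_eq_homCayley, coe_smul_eq, ← homCayley_smul h, mul_div_cancel₀ _ h]
  simp

@[simp] lemma circlePt_infty : circlePt OnePoint.infty = 1 := rfl

@[simp] lemma circlePt_coe (x : ℝ) : circlePt (x : OnePoint ℝ) = cayley x := rfl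

lemma bdryAct_infty (g : SL(2, ℝ)) : bdryAct g OnePoint.infty =
    if g 1 0 = 0 then OnePoint.infty else ((g 0 0 / g 1 0 : ℝ) : OnePoint ℝ) :=
  OnePoint.smul_infty_eq_ite _

lemma bdryAct_coe (g : SL(2, ℝ)) (x : ℝ) : bdryAct g (x : OnePoint ℝ) =
    if g 1 0 * x + g 1 1 = 0 then OnePoint.infty
    else (((g 0 0 * x + g 0 1) / (g 1 0 * x + g 1 1) : ℝ) : OnePoint ℝ) :=
  OnePoint.smul_some_eq_ite

/-- Infinity is `(1 : 0)` and a real `x` is `(x : 1)`. The case distinctions of the boundary action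
are settled here once and for all. -/
lemma exists_homCayley (η : OnePoint ℝ) : ∃ p q : ℝ, IsClosedHalfPlane p q ∧
    circlePt η = homCayley p q ∧ ∀ g : SL(2, ℝ), circlePt (bdryAct g η) =
      homCayley (g 0 0 * p + g 0 1 * q) (g 1 0 * p + g 1 1 * q) := by
  have ha : ∀ a : ℂ, a ≠ 0 → homCayley a 0 = 1 := by
    intro a h
    simp [homCayley, h]
  induction η using OnePoint.rec with
  | infty =>
    refine ⟨1, 0, ⟨by simp, Or.inl (by simp)⟩, by simp [homCayley], fun g => ?_⟩
    have hd := coe_det_eq_one g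
    by_cases h : g 1 0 = 0
    · have h00 : (g 0 0 : ℂ) ≠ 0 := by
        intro h0
        have h0 : g 0 0 = 0 := by exact_mod_cast h0
        rw [h0, h] at hd
        simp at hd
      simp [bdryAct_infty, h, ha _ h00]
    · rw [bdryAct_infty, if_neg h]
      have h : (g 1 0 : ℂ) ≠ 0 := by exact_mod_cast h
      rw [circlePt_coe, cayley_eq_homCayley, ← homCayley_smul h]
      push_cast
      rw [mul_div_cancel₀ _ h]
      simp
  | coe x =>
    refine ⟨x, 1, ⟨by simp, Or.inr (by simp)⟩, by simp [cayley_eq_homCayley], fun g => ?_⟩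
    have hd := coe_det_eq_one g
    by_cases h : g 1 0 * x + g 1 1 = 0
    · rw [bdryAct_coe, if_pos h]
      have h00 : (g 0 0 * x + g 0 1 : ℂ) ≠ 0 := by
        intro h0
        have h0 : g 0 0 * x + g 0 1 = 0 := by exact_mod_cast h0
        have h10 : g 1 0 = 0 := by linear_combination g 1 0 * g 0 0 * h - g 1 0 * g 1 0 * h0 - g 1 0 * hd
        have h11 : g 1 1 = 0 := by linear_combination h - x * h10
        rw [h10, h11] at hd
        simp at hd
      have h' : (g 1 0 * x + g 1 1 : ℂ) = 0 := by exact_mod_cast h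
      simp [h', ha _ h00]
    · rw [bdryAct_coe, if_neg h]
      have h : (g 1 0 * x + g 1 1 : ℂ) ≠ 0 := by exact_mod_cast h
      rw [circlePt_coe, cayley_eq_homCayley, ← homCayley_smul h]
      push_cast
      rw [mul_div_cancel₀ _ h]
      simp

lemma dist_circlePt_bdryAct_le (g : SL(2, ℝ)) (ξ η : OnePoint ℝ) :
    dist (circlePt (bdryAct g ξ)) (circlePt (bdryAct g η)) ≤
      4 * Real.exp (displacement g) * dist (circlePt ξ) (circlePt η) := by
  obtain ⟨p, q, h, e, f⟩ := exists_homCayley ξ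
  obtain ⟨p', q', h', e', f'⟩ := exists_homCayley η
  rw [e, e', f, f']
  exact dist_homCayley_apply_le g h h'

lemma dist_cayley_smul_circlePt_le (g : SL(2, ℝ)) (z : ℍ) (η : OnePoint ℝ) :
    dist (cayley (g • z : ℍ)) (circlePt (bdryAct g η)) ≤
      4 * Real.exp (displacement g) * dist (cayley z) (circlePt η) := by
  obtain ⟨p, q, h, e, f⟩ := exists_homCayley η
  rw [e, f, cayley_smul, cayley_eq_homCayley]
  exact dist_homCayley_apply_le g (isClosedHalfPlane_coe z) h

lemma tendsto_smul_approach (g : SL(2, ℝ)) (η : OnePoint ℝ) :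
    Tendsto (fun z : ℍ => g • z) (approach η) (approach (bdryAct g η)) := by
  refine tendsto_comap_iff.2 (tendsto_iff_dist_tendsto_zero.2 ?_)
  have h : Tendsto (fun z : ℍ => dist (cayley z) (circlePt η)) (approach η) (𝓝 0) :=
    tendsto_iff_dist_tendsto_zero.1 tendsto_comap
  refine squeeze_zero (fun _ => dist_nonneg)
    (fun z => dist_cayley_smul_circlePt_le g z η) ?_
  simpa using h.const_mul (4 * Real.exp (displacement g))

lemma bdryAct_mem_limitSet {G : Subgroup SL(2, ℝ)} {h : SL(2, ℝ)} (hh : h ∈ G) {η : OnePoint ℝ}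
    (hη : η ∈ limitSet G) : bdryAct h η ∈ limitSet G := by
  obtain ⟨g, hg, hlim⟩ := hη
  refine ⟨fun n => h * g n, fun n => G.mul_mem hh (hg n), ?_⟩
  simpa only [mul_smul] using! (tendsto_smul_approach h η).comp hlim

lemma bdryAct_mul (g h : SL(2, ℝ)) (η : OnePoint ℝ) :
    bdryAct (g * h) η = bdryAct g (bdryAct h η) := by
  simp [bdryAct, mul_smul]

@[simp] lemma bdryAct_one (η : OnePoint ℝ) : bdryAct 1 η = η := by
  simp [bdryAct]

lemma bdryAct_inv_bdryAct (g : SL(2, ℝ)) (η : OnePoint ℝ) : bdryAct g⁻¹ (bdryAct g η) = η := by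
  rw [← bdryAct_mul, inv_mul_cancel, bdryAct_one]

lemma bdryAct_bdryAct_inv (g : SL(2, ℝ)) (η : OnePoint ℝ) : bdryAct g (bdryAct g⁻¹ η) = η := by
  rw [← bdryAct_mul, mul_inv_cancel, bdryAct_one]

lemma radialLimitSetOf_subset (G : Subgroup SL(2, ℝ)) (σ : ℝ) :
    radialLimitSetOf G σ ⊆ limitSet G := fun _ ⟨g, hg, hlim, _⟩ => ⟨g, hg, hlim⟩

lemma radialLimitSet_subset (G : Subgroup SL(2, ℝ)) : radialLimitSet G ⊆ limitSet G :=
  fun _ ⟨σ, _, h⟩ => radialLimitSetOf_subset G σ h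

lemma add_I_ne_zero {z : ℂ} (hz : 0 ≤ z.im) : z + I ≠ 0 := by
  intro h
  have := congrArg Complex.im h
  simp at this
  linarith

lemma dist_cayley_one {z : ℂ} (hz : 0 ≤ z.im) : dist (cayley z) 1 = 2 / ‖z + I‖ := by
  have h := add_I_ne_zero hz
  rw [dist_eq_norm, cayley, div_sub_one h, norm_div,
    show z - I - (z + I) = -(2 * I) by ring]
  simp

lemma dist_cayley_le {z w : ℂ} (hz : 0 ≤ z.im) (hw : 0 ≤ w.im) :
    dist (cayley z) (cayley w) ≤ 2 * dist z w := by
  have h := add_I_ne_zero hz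
  have h' := add_I_ne_zero hw
  have n1 : ∀ v : ℂ, 0 ≤ v.im → 1 ≤ ‖v + I‖ := by
    intro v hv
    refine le_trans ?_ (Complex.abs_im_le_norm _)
    simp
    exact le_trans (by linarith) (le_abs_self _)
  rw [cayley_eq_homCayley, cayley_eq_homCayley, dist_homCayley (by simpa) (by simpa), dist_eq_norm]
  simp only [mul_one, one_mul]
  refine div_le_self (by positivity) ?_
  nlinarith [n1 z hz, n1 w hw]

lemma visualDist_infty_coe (x : ℝ) :
    visualDist OnePoint.infty (x : OnePoint ℝ) = 1 / √(x ^ 2 + 1) := by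
  rw [visualDist, dist_comm, circlePt_infty, circlePt_coe, dist_cayley_one (by simp),
    Complex.norm_eq_sqrt_sq_add_sq]
  simp
  ring

lemma tendsto_approach_coe {u : ℕ → ℍ} {x : ℝ} (h : Tendsto u atTop (approach (x : OnePoint ℝ))) :
    Tendsto (fun n => (u n : ℂ)) atTop (𝓝 (x : ℂ)) := by
  have h1 : Tendsto (fun n => cayley (u n)) atTop (𝓝 (cayley x)) := tendsto_comap_iff.1 h
  have hne : ∀ z : ℂ, 0 ≤ z.im → 1 - cayley z ≠ 0 ∧ I * (1 + cayley z) / (1 - cayley z) = z := by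
    intro z hz
    have h := add_I_ne_zero hz
    have e : 1 - cayley z = 2 * I / (z + I) := by
      rw [cayley]; field_simp; ring
    have e' : 1 + cayley z = 2 * z / (z + I) := by
      rw [cayley]; field_simp; ring
    have hI := I_ne_zero
    rw [e, e']
    refine ⟨by simp [h], by field_simp⟩
  -- The inverse Cayley transform `w ↦ I (1 + w) / (1 - w)` is continuous away from `w = 1`, the
  -- image of infinity.
  have h2 := ((h1.const_add 1).const_mul I).div (h1.const_sub 1) (hne x (by simp)).1
  rw [(hne x (by simp)).2] at h2
  exact h2.congr fun n => (hne (u n) (by simpa using (u n).im_pos.le)).2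

/-! ### The Schottky generators -/

/-- Letters are the generators (`true`) and their inverses (`false`). -/
abbrev Letter := ℕ × Bool

/-- The centre of the attracting disc of a letter. -/
def center (a : Letter) : ℝ := 2 * a.1 + if a.2 then 1 else 0

/-- The radius of the discs of the `n`-th generator. -/
def rad (n : ℕ) : ℝ := (1 / 2) ^ n / 8

/-- The inverse letter. -/
def flip (a : Letter) : Letter := (a.1, !a.2)

lemma rad_pos (n : ℕ) : 0 < rad n := by unfold rad; positivity

lemma rad_le (n : ℕ) : rad n ≤ 1 / 8 := by
  unfold rad
  have : (1 / 2 : ℝ) ^ n ≤ 1 := pow_le_one₀ (by norm_num) (by norm_num)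
  linarith

lemma one_le_abs_center_sub {a b : Letter} (h : a ≠ b) : 1 ≤ |center a - center b| := by
  have key : (1 : ℤ) ≤ |(2 * a.1 + if a.2 then 1 else 0 : ℤ) - (2 * b.1 + if b.2 then 1 else 0)| := by
    obtain ⟨m, s⟩ := a
    obtain ⟨n, t⟩ := b
    refine Int.one_le_abs ?_
    contrapose! h
    cases s <;> cases t <;> simp at h ⊢ <;> omega
  have := (Int.cast_le (R := ℝ)).2 key
  unfold center
  push_cast at this
  simpa using this

lemma center_nonneg (a : Letter) : 0 ≤ center a := by
  unfold center
  split_ifs <;> positivity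

lemma center_le (a : Letter) : center a ≤ 2 * a.1 + 1 := by
  unfold center
  split_ifs <;> simp

/-- The generator that maps the exterior of the disc with centre `2n` onto the interior of the
disc with centre `2n + 1`. -/
def gen (n : ℕ) : SL(2, ℝ) :=
  ⟨!![center (n, true) / rad n, (-center (n, true) * center (n, false) - rad n ^ 2) / rad n;
      1 / rad n, -center (n, false) / rad n], by
    have := (rad_pos n).ne'
    rw [Matrix.det_fin_two_of]
    field_simp
    ring⟩

/-- The group element of a letter. -/
def letter (a : Letter) : SL(2, ℝ) := cond a.2 (gen a.1) (gen a.1)⁻¹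

lemma coe_sub_ofReal_ne_zero (z : ℍ) (x : ℝ) : (z - x : ℂ) ≠ 0 := by
  intro h
  have := congrArg Complex.im h
  simp at this
  exact z.im_pos.ne' this

lemma coe_letter_smul (a : Letter) (z : ℍ) :
    ((letter a • z : ℍ) : ℂ) = center a - (rad a.1 : ℂ) ^ 2 / (z - center (flip a)) := by
  obtain ⟨n, s⟩ := a
  have hr : (rad n : ℂ) ≠ 0 := by exact_mod_cast (rad_pos n).ne'
  have gen_smul : ∀ w : ℍ, ((gen n • w : ℍ) : ℂ) =
      center (n, true) - (rad n : ℂ) ^ 2 / (w - center (n, false)) := by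
    intro w
    have hw := coe_sub_ofReal_ne_zero w (center (n, false))
    have hd := denominator_ne_zero (gen n) w
    rw [coe_smul_eq]
    rw [div_eq_iff hd]
    simp only [gen, Matrix.of_apply, Matrix.cons_val', Matrix.cons_val_zero, Matrix.cons_val_one,
      Matrix.cons_val_fin_one]
    push_cast
    field_simp
    ring
  cases s
  -- For the inverse letter, solve the formula for `gen n` for its argument.
  · set w := letter (n, false) • z with hw
    have hz : gen n • w = z := by simp [hw, letter]
    have h := gen_smul w
    rw [hz] at h
    have hw' := coe_sub_ofReal_ne_zero w (center (n, false))
    simp only [flip, Bool.not_false]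
    rw [h]
    field_simp
    ring
  · exact gen_smul z

lemma im_letter_smul (a : Letter) (z : ℍ) :
    (letter a • z : ℍ).im = rad a.1 ^ 2 * z.im / ‖(z - center (flip a) : ℂ)‖ ^ 2 := by
  rw [← UpperHalfPlane.coe_im, coe_letter_smul, ← normSq_eq_norm_sq]
  have hre : ((rad a.1 : ℂ) ^ 2).re = rad a.1 ^ 2 := by rw [← ofReal_pow, ofReal_re]
  have him : ((rad a.1 : ℂ) ^ 2).im = 0 := by rw [← ofReal_pow, ofReal_im]
  rw [sub_im, div_im, hre, him]
  simp

lemma dist_letter_smul (a : Letter) (z : ℍ) :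
    dist ((letter a • z : ℍ) : ℂ) (center a) = rad a.1 ^ 2 / dist (z : ℂ) (center (flip a)) := by
  rw [coe_letter_smul, dist_eq_norm, dist_eq_norm]
  simp

/-- The group element of a word. -/
def wordEval (L : List Letter) : SL(2, ℝ) := (L.map letter).prod

@[simp] lemma wordEval_nil : wordEval [] = 1 := rfl

lemma wordEval_cons (a : Letter) (L : List Letter) :
    wordEval (a :: L) = letter a * wordEval L := by simp [wordEval]

/-- Reducedness keeps the point out of the disc that `a` repels: it lies in a disc whose centre is
at distance at least `1`, with radius at most `1 / 8`. For the empty word it is `i`, at height `1`.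
-/
lemma half_le_dist_wordEval {a : Letter} {L : List Letter}
    (h : FreeGroup.IsReduced (a :: L)) (hL : ∀ b ∈ L.head?,
      dist ((wordEval L • UpperHalfPlane.I : ℍ) : ℂ) (center b) ≤ rad b.1) :
    1 / 2 ≤ dist ((wordEval L • UpperHalfPlane.I : ℍ) : ℂ) (center (flip a)) := by
  cases L with
  | nil =>
    rw [dist_eq_norm]
    refine le_trans ?_ (Complex.abs_im_le_norm _)
    simp
    norm_num
  | cons b L =>
    have hb := hL b (by simp)
    have hne : b ≠ flip a := by
      rintro rfl
      rw [FreeGroup.isReduced_cons_cons] at h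
      simpa [flip] using h.1
    have h1 := one_le_abs_center_sub hne
    have h2 : dist (center b : ℂ) (center (flip a)) = |center b - center (flip a)| := by
      rw [Complex.dist_of_im_eq (by simp), ofReal_re, ofReal_re, Real.dist_eq]
    have h3 := dist_triangle_left (center b : ℂ) (center (flip a))
      ((wordEval (b :: L) • UpperHalfPlane.I : ℍ) : ℂ)
    linarith [rad_le b.1]

/-- Ping-pong: by `half_le_dist_wordEval` the new distance is at most `r ^ 2 / (1 / 2) ≤ r`. -/
lemma dist_wordEval_head_le : ∀ {L : List Letter}, FreeGroup.IsReduced L → ∀ b ∈ L.head?,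
    dist ((wordEval L • UpperHalfPlane.I : ℍ) : ℂ) (center b) ≤ rad b.1
  | [], _, b, hb => by simp at hb
  | a :: L, h, b, hb => by
    obtain rfl : a = b := by simpa using hb
    have hL : FreeGroup.IsReduced L := h.infix ⟨[a], [], by simp⟩
    have h1 := half_le_dist_wordEval h (dist_wordEval_head_le hL)
    rw [wordEval_cons, mul_smul, dist_letter_smul]
    have hr := rad_pos a.1
    have hr' := rad_le a.1
    rw [div_le_iff₀ (by linarith)]
    nlinarith

/-- The factor by which a letter of a reduced word contracts the height. -/
def contraction (a : Letter) : ℝ := (1 / 2) ^ a.1 / 16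

lemma contraction_nonneg (a : Letter) : 0 ≤ contraction a := by unfold contraction; positivity

/-- A letter multiplies the height by `r ^ 2` over a squared distance of at least `1 / 4`, and `4 *
r ^ 2 ≤ r / 2` because `r ≤ 1 / 8`. -/
lemma im_wordEval_le : ∀ {L : List Letter}, FreeGroup.IsReduced L →
    (wordEval L • UpperHalfPlane.I : ℍ).im ≤ (L.map contraction).prod
  | [], _ => by simp
  | a :: L, h => by
    have hL : FreeGroup.IsReduced L := h.infix ⟨[a], [], by simp⟩
    have h1 := half_le_dist_wordEval h (dist_wordEval_head_le hL)
    have ih := im_wordEval_le hL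
    rw [wordEval_cons, mul_smul, im_letter_smul, List.map_cons, List.prod_cons]
    rw [dist_eq_norm] at h1
    have him := (wordEval L • UpperHalfPlane.I : ℍ).im_pos
    have hr := rad_pos a.1
    have hr' := rad_le a.1
    have hc : 4 * rad a.1 ^ 2 ≤ contraction a := by
      have : contraction a = rad a.1 / 2 := by unfold contraction rad; ring
      rw [this]
      nlinarith
    have hsq : 1 / 4 ≤ ‖((wordEval L • UpperHalfPlane.I : ℍ) - center (flip a) : ℂ)‖ ^ 2 := by
      nlinarith
    calc _ ≤ 4 * rad a.1 ^ 2 * (wordEval L • UpperHalfPlane.I : ℍ).im := by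
          rw [div_le_iff₀ (by linarith)]
          have : 0 < rad a.1 ^ 2 * (wordEval L • UpperHalfPlane.I : ℍ).im := by positivity
          nlinarith
      _ ≤ _ := mul_le_mul hc ih him.le (contraction_nonneg a)

/-! ### The Schottky group -/

/-- The Schottky group. -/
def schottky : Subgroup SL(2, ℝ) := Subgroup.closure (Set.range gen)

/-- The evaluation of the free group. -/
def eval : FreeGroup ℕ →* SL(2, ℝ) := FreeGroup.lift gen

lemma eval_eq (w : FreeGroup ℕ) : eval w = wordEval w.toWord := by
  conv_lhs => rw [← FreeGroup.mk_toWord (x := w)]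
  rw [eval, FreeGroup.lift_mk]
  rfl

lemma range_eval : eval.range = schottky := FreeGroup.range_lift_eq_closure

lemma exists_eval_eq {g : SL(2, ℝ)} (hg : g ∈ schottky) : ∃ w, eval w = g := by
  rwa [← range_eval] at hg

lemma letter_mem (a : Letter) : letter a ∈ schottky := by
  have h : gen a.1 ∈ schottky := Subgroup.subset_closure ⟨_, rfl⟩
  obtain ⟨n, s⟩ := a
  cases s
  · exact inv_mem h
  · exact h

lemma exists_dist_center_le {w : FreeGroup ℕ} (hw : w ≠ 1) : ∃ b ∈ w.toWord.head?,
    dist ((eval w • UpperHalfPlane.I : ℍ) : ℂ) (center b) ≤ rad b.1 := by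
  rw [eval_eq]
  cases h : w.toWord with
  | nil => exact absurd (FreeGroup.toWord_eq_nil_iff.1 h) hw
  | cons a L =>
    refine ⟨a, by simp, dist_wordEval_head_le ?_ a (by simp)⟩
    rw [← h]
    exact FreeGroup.isReduced_toWord

lemma im_le_of_dist_center_le {z : ℍ} {b : Letter} (h : dist (z : ℂ) (center b) ≤ rad b.1) :
    z.im ≤ 1 / 8 := by
  have h1 : |(z - center b : ℂ).im| ≤ _ := Complex.abs_im_le_norm _
  rw [← dist_eq_norm] at h1
  simp at h1
  linarith [le_abs_self z.im, rad_le b.1]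

/-- This gap below the height `1` of `i` gives both freeness and discreteness. -/
lemma im_eval_le {w : FreeGroup ℕ} (hw : w ≠ 1) :
    (eval w • UpperHalfPlane.I : ℍ).im ≤ 1 / 8 := by
  obtain ⟨b, -, hb⟩ := exists_dist_center_le hw
  exact im_le_of_dist_center_le hb

lemma eval_injective : Function.Injective eval := by
  rw [injective_iff_map_eq_one]
  intro w h
  by_contra hw
  have := im_eval_le hw
  rw [h, one_smul, UpperHalfPlane.I_im] at this
  norm_num at this

instance : Countable schottky := by
  have : Function.Surjective (fun w : FreeGroup ℕ => (⟨eval w, by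
      rw [← range_eval]; exact ⟨w, rfl⟩⟩ : schottky)) := by
    rintro ⟨g, hg⟩
    obtain ⟨w, rfl⟩ := exists_eval_eq hg
    exact ⟨w, rfl⟩
  have : Countable (FreeGroup ℕ) := FreeGroup.toWord_injective.countable
  exact Function.Surjective.countable ‹_›

lemma discreteTopology_schottky : DiscreteTopology schottky := by
  refine discreteTopology_of_isOpen_singleton_one ?_
  -- This function is `1 / Im (g i)`: it equals `1` at the identity and is at least `8` at every
  -- other element.
  have hcont : Continuous fun g : schottky => (g : SL(2, ℝ)) 1 0 ^ 2 + (g : SL(2, ℝ)) 1 1 ^ 2 := by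
    have hval : Continuous fun g : SL(2, ℝ) => (g : Matrix (Fin 2) (Fin 2) ℝ) :=
      continuous_induced_dom
    have h : ∀ i j, Continuous fun g : schottky => (g : SL(2, ℝ)) i j := fun i j =>
      (hval.matrix_elem i j).comp (continuous_subtype_val (p := (· ∈ schottky)))
    exact ((h 1 0).pow 2).add ((h 1 1).pow 2)
  convert (isOpen_Iio (a := (2 : ℝ))).preimage hcont
  ext ⟨g, hg⟩
  obtain ⟨w, rfl⟩ := exists_eval_eq hg
  simp only [Set.mem_singleton_iff, Set.mem_preimage, Set.mem_Iio]
  constructor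
  · intro h
    have h : eval w = 1 := congrArg Subtype.val h
    simp [h]
  · intro h
    by_contra hne
    have hw : w ≠ 1 := by
      rintro rfl
      exact hne (Subtype.ext (map_one eval))
    have h1 := im_eval_le hw
    have h2 := (eval w • UpperHalfPlane.I : ℍ).im_pos
    rw [im_smul_I] at h1 h2
    rw [div_le_iff₀ (one_div_pos.1 h2)] at h1
    linarith

/-- The exponent sum of a generator in an element of the free group. -/
def exponentSum (N : ℕ) : FreeGroup ℕ →* Multiplicative ℤ :=
  FreeGroup.lift fun n => if n = N then Multiplicative.ofAdd 1 else 1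

lemma eventually_exponentSum_eq_one (w : FreeGroup ℕ) :
    ∀ᶠ N in atTop, exponentSum N w = 1 := by
  induction w using FreeGroup.induction_on with
  | C1 => simp
  | of n =>
    filter_upwards [eventually_gt_atTop n] with N hN
    simp [exponentSum, hN.ne]
  | inv_of n h => simpa using h
  | mul x y hx hy =>
    filter_upwards [hx, hy] with N h1 h2
    simp [h1, h2]

/-- Finitely many elements involve finitely many generators, so some exponent sum vanishes on all of
them but not on the group. -/
lemma not_fg_freeGroup : ¬ (⊤ : Subgroup (FreeGroup ℕ)).FG := by
  rintro ⟨S, hS⟩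
  obtain ⟨N, hN⟩ := ((S.eventually_all).2
    fun w _ => eventually_exponentSum_eq_one w).exists
  have h : (⊤ : Subgroup (FreeGroup ℕ)) ≤ (exponentSum N).ker := by
    rw [← hS, Subgroup.closure_le]
    exact hN
  have := h (Subgroup.mem_top (FreeGroup.of N))
  simp [exponentSum, MonoidHom.mem_ker] at this

lemma not_fg_schottky : ¬ schottky.FG := by
  intro h
  rw [← range_eval, ← Group.fg_iff_subgroup_fg] at h
  exact not_fg_freeGroup (Group.fg_def.1
    (Group.fg_of_surjective (MonoidHom.ofInjective eval_injective).symm.surjective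
      (f := (MonoidHom.ofInjective eval_injective).symm.toMonoidHom)))

lemma isInfiniteSchottky_schottky : IsInfiniteSchottky schottky := by
  have hdisj : ∀ a b : Letter, a ≠ b →
      Disjoint (Metric.closedBall (center a : ℂ) (rad a.1))
        (Metric.closedBall (center b : ℂ) (rad b.1)) := by
    intro a b h
    refine Metric.closedBall_disjoint_closedBall ?_
    rw [Complex.dist_of_im_eq (by simp), ofReal_re, ofReal_re, Real.dist_eq]
    linarith [one_le_abs_center_sub h, rad_le a.1, rad_le b.1]
  refine ⟨gen, fun n => center (n, false), fun n => center (n, true), rad, rad, rfl,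
    fun n => ⟨rad_pos n, rad_pos n⟩, ?_, ?_, ?_, ?_⟩
  · exact fun m n h => hdisj (m, false) (n, false) (by simpa using h)
  · exact fun m n h => hdisj (m, true) (n, true) (by simpa using h)
  · exact fun m n => hdisj (m, false) (n, true) (by simp)
  · intro n z
    have h : dist ((gen n • z : ℍ) : ℂ) (center (n, true)) =
        rad n ^ 2 / dist (z : ℂ) (center (n, false)) := dist_letter_smul (n, true) z
    have hpos : 0 < dist (z : ℂ) (center (n, false)) := by
      rw [dist_eq_norm]
      exact norm_pos_iff.2 (coe_sub_ofReal_ne_zero _ _)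
    have hr := rad_pos n
    rw [h, div_lt_iff₀ hpos, sq, mul_lt_mul_iff_right₀ hr]

/-! ### Convergence of the Poincaré series -/

lemma tsum_list_prod {α : Type*} (f : α → ℝ≥0∞) (k : ℕ) :
    ∑' v : List.Vector α k, (v.toList.map f).prod = (∑' a, f a) ^ k := by
  induction k with
  | zero =>
    rw [tsum_eq_single List.Vector.nil fun v hv => absurd v.eq_nil hv]
    simp
  | succ k ih =>
    let e : α × List.Vector α k ≃ List.Vector α (k + 1) :=
      { toFun := fun p => p.1 ::ᵥ p.2
        invFun := fun v => (v.head, v.tail)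
        left_inv := fun p => by simp
        right_inv := fun v => by simp }
    rw [← e.tsum_eq, ENNReal.tsum_prod', pow_succ, mul_comm, ← ENNReal.tsum_mul_right]
    refine tsum_congr fun a => ?_
    rw [← ih, ← ENNReal.tsum_mul_left]
    refine tsum_congr fun v => ?_
    simp [e]

lemma tsum_list_prod_eq {α : Type*} (f : α → ℝ≥0∞) :
    ∑' L : List α, (L.map f).prod = ∑' k, (∑' a, f a) ^ k := by
  let e : (Σ k, List.Vector α k) ≃ List α :=
    { toFun := fun p => p.2.toList
      invFun := fun L => ⟨L.length, ⟨L, rfl⟩⟩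
      left_inv := by rintro ⟨_, L, rfl⟩; rfl
      right_inv := fun L => rfl }
  rw [← e.tsum_eq, ENNReal.tsum_sigma']
  exact tsum_congr fun k => tsum_list_prod f k

lemma tsum_contraction_lt_one : ∑' a : Letter, ENNReal.ofReal (contraction a) < 1 := by
  have h : ∑' n : ℕ, ENNReal.ofReal ((1 / 2) ^ n / 16) = ENNReal.ofReal (1 / 8) := by
    rw [← ENNReal.ofReal_tsum_of_nonneg (fun n => by positivity)
      (summable_geometric_two.div_const 16), tsum_div_const, tsum_geometric_two]
    norm_num
  rw [ENNReal.tsum_prod']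
  simp only [contraction, tsum_fintype, Fintype.sum_bool]
  rw [ENNReal.tsum_add, h, ← ENNReal.ofReal_add (by norm_num) (by norm_num),
    ENNReal.ofReal_lt_one]
  norm_num

/-- Each term is at most the height of the orbit point, hence at most a product of contractions.
Enlarging the sum from reduced words to all words gives a geometric series with ratio `1 / 4`. -/
lemma tsum_exp_neg_displacement_lt_top :
    ∑' g : schottky, ENNReal.ofReal (Real.exp (-displacement g)) < ∞ := by
  have hsurj : Function.Surjective (fun w : FreeGroup ℕ => (⟨eval w, by
      rw [← range_eval]; exact ⟨w, rfl⟩⟩ : schottky)) := by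
    rintro ⟨g, hg⟩
    obtain ⟨w, rfl⟩ := exists_eval_eq hg
    exact ⟨w, rfl⟩
  calc _ ≤ ∑' w : FreeGroup ℕ, ENNReal.ofReal (Real.exp (-displacement (eval w))) :=
        ENNReal.tsum_le_tsum_comp_of_surjective hsurj _
    _ ≤ ∑' w : FreeGroup ℕ, (w.toWord.map fun a => ENNReal.ofReal (contraction a)).prod := by
        refine ENNReal.tsum_le_tsum fun w => ?_
        have h1 := (exp_neg_displacement_le (eval w)).trans
          (eval_eq w ▸ im_wordEval_le FreeGroup.isReduced_toWord)
        refine (ENNReal.ofReal_le_ofReal h1).trans_eq ?_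
        induction w.toWord with
        | nil => simp
        | cons a L ih => simp [ENNReal.ofReal_mul (contraction_nonneg a), ih]
    _ ≤ ∑' L : List Letter, (L.map fun a => ENNReal.ofReal (contraction a)).prod :=
        ENNReal.tsum_comp_le_tsum_of_injective FreeGroup.toWord_injective _
    _ = (1 - ∑' a : Letter, ENNReal.ofReal (contraction a))⁻¹ := by
        rw [tsum_list_prod_eq, ENNReal.tsum_geometric]
    _ < ∞ := by
        rw [ENNReal.inv_lt_top]
        exact tsub_pos_of_lt tsum_contraction_lt_one

/-! ### The limit set -/

lemma tendsto_letter_smul (s : Bool) : Tendsto (fun n => letter (n, s) • UpperHalfPlane.I) atTop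
    (approach OnePoint.infty) := by
  refine tendsto_comap_iff.2 (tendsto_iff_dist_tendsto_zero.2 ?_)
  simp only [Function.comp_apply, circlePt_infty, dist_cayley_one (UpperHalfPlane.im_pos _).le]
  refine tendsto_const_nhds.div_atTop (tendsto_atTop_mono (fun n => ?_)
    tendsto_natCast_atTop_atTop)
  have h1 : dist ((letter (n, s) • UpperHalfPlane.I : ℍ) : ℂ) (center (n, s)) ≤ rad n := by
    have := dist_wordEval_head_le (L := [(n, s)]) FreeGroup.IsReduced.singleton (n, s) (by simp)
    simpa [wordEval] using this
  have h2 := (Complex.abs_re_le_norm _).trans ((dist_eq_norm _ _).symm.trans_le h1)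
  rw [sub_re, ofReal_re] at h2
  have h3 := neg_le_of_abs_le h2
  have h4 := rad_le n
  have h5 : 2 * (n : ℝ) ≤ center (n, s) := by unfold center; split_ifs <;> simp
  have h6 := (le_abs_self _).trans
    (Complex.abs_re_le_norm ((letter (n, s) • UpperHalfPlane.I : ℍ) + I : ℂ))
  have h7 := (le_abs_self _).trans
    (Complex.abs_im_le_norm ((letter (n, s) • UpperHalfPlane.I : ℍ) + I : ℂ))
  have h8 := (letter (n, s) • UpperHalfPlane.I : ℍ).im_pos
  simp only [add_re, add_im, I_re, I_im, UpperHalfPlane.coe_im] at h6 h7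
  rcases Nat.eq_zero_or_pos n with rfl | hn
  · simp
  · have : (1 : ℝ) ≤ n := by exact_mod_cast hn
    linarith

lemma infty_mem_limitSet : OnePoint.infty ∈ limitSet schottky :=
  ⟨fun n => letter (n, true), fun _ => letter_mem _, tendsto_letter_smul true⟩

lemma bdryAct_gen_infty (n : ℕ) :
    bdryAct (gen n) OnePoint.infty = (center (n, true) : OnePoint ℝ) := by
  have h := (rad_pos n).ne'
  rw [bdryAct_infty]
  simp [gen, h]

lemma nonelementary_schottky : Nonelementary schottky := by
  have hsub : {OnePoint.infty, bdryAct (gen 0) OnePoint.infty, bdryAct (gen 1) OnePoint.infty} ⊆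
      limitSet schottky := by
    rintro x (rfl | rfl | rfl)
    · exact infty_mem_limitSet
    · exact bdryAct_mem_limitSet (letter_mem (0, true)) infty_mem_limitSet
    · exact bdryAct_mem_limitSet (letter_mem (1, true)) infty_mem_limitSet
  refine le_trans ?_ (Set.encard_le_encard hsub)
  rw [Set.encard_eq_three.2 ⟨_, _, _, ?_, ?_, ?_, rfl⟩]
  · simp [bdryAct_gen_infty]
  · simp [bdryAct_gen_infty]
  · rw [bdryAct_gen_infty, bdryAct_gen_infty]
    simp [center]

/-- The trace on the boundary of the disc of a letter. -/
def boundaryInterval (a : Letter) : Set (OnePoint ℝ) :=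
  {η | ∃ x : ℝ, η = (x : OnePoint ℝ) ∧ |x - center a| ≤ rad a.1}

/-- Near a finite point only finitely many discs matter, and their union is closed. -/
lemma exists_mem_boundaryInterval {x : ℝ} (hx : (x : OnePoint ℝ) ∈ limitSet schottky) :
    ∃ a, (x : OnePoint ℝ) ∈ boundaryInterval a := by
  obtain ⟨g, hg, hlim⟩ := hx
  have h := tendsto_approach_coe hlim
  -- Height below `1` excludes the identity, the only element whose orbit point is in no disc.
  have hIm : ∀ᶠ n in atTop, ((g n • UpperHalfPlane.I : ℍ) : ℂ).im < 1 := by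
    have := (Complex.continuous_im.tendsto _).comp h
    exact this.eventually (gt_mem_nhds (by simp))
  have hRe : ∀ᶠ n in atTop, ((g n • UpperHalfPlane.I : ℍ) : ℂ).re < x + 1 := by
    have := (Complex.continuous_re.tendsto _).comp h
    exact this.eventually (gt_mem_nhds (by simp))
  obtain ⟨K, hK⟩ := exists_nat_gt (x + 2)
  set T : Set ℂ := ⋃ a ∈ (Finset.range K ×ˢ Finset.univ : Finset Letter),
    Metric.closedBall (center a : ℂ) (rad a.1) with hT
  have hclosed : IsClosed T :=
    Set.Finite.isClosed_biUnion (Finset.finite_toSet _) fun _ _ => Metric.isClosed_closedBall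
  have hmem : (x : ℂ) ∈ T := by
    refine hclosed.mem_of_tendsto h ?_
    filter_upwards [hIm, hRe] with n h1 h2
    obtain ⟨w, hw⟩ := exists_eval_eq (hg n)
    have hw1 : w ≠ 1 := by
      rintro rfl
      rw [← hw, map_one, one_smul] at h1
      simp at h1
    obtain ⟨b, -, hb⟩ := exists_dist_center_le hw1
    rw [hw] at hb
    have hre : |((g n • UpperHalfPlane.I : ℍ) - center b : ℂ).re| ≤ _ := Complex.abs_re_le_norm _
    rw [← dist_eq_norm, sub_re, ofReal_re] at hre
    have h3 := neg_le_of_abs_le hre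
    have h4 := rad_le b.1
    have h5 : 2 * (b.1 : ℝ) ≤ center b := by unfold center; split_ifs <;> simp
    have h6 : (b.1 : ℝ) < K := by linarith [Nat.cast_nonneg (α := ℝ) b.1]
    simp only [hT, Set.mem_iUnion]
    exact ⟨b, by simpa using h6, hb⟩
  simp only [hT, Set.mem_iUnion] at hmem
  obtain ⟨a, -, ha⟩ := hmem
  refine ⟨a, x, rfl, ?_⟩
  rwa [Metric.mem_closedBall, Complex.dist_of_im_eq (by simp), ofReal_re, ofReal_re,
    Real.dist_eq] at ha

/-! ### Estimates near the point at infinity -/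

/-- The constant is `4 * 2 * 2`: the distortion of `g`, the Lipschitz constant of the Cayley
transform, and diameter against radius. -/
lemma ediam_image_boundaryInterval_le (g : SL(2, ℝ)) (a : Letter) :
    Metric.ediam (circlePt '' (bdryAct g '' boundaryInterval a)) ≤
      ENNReal.ofReal (16 * (Real.exp (displacement g) * rad a.1)) := by
  refine Metric.ediam_le ?_
  rintro _ ⟨_, ⟨_, ⟨x, rfl, hx⟩, rfl⟩, rfl⟩ _ ⟨_, ⟨_, ⟨y, rfl, hy⟩, rfl⟩, rfl⟩
  rw [edist_dist]
  refine ENNReal.ofReal_le_ofReal ((dist_circlePt_bdryAct_le g _ _).trans ?_)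
  have h1 : dist (circlePt (x : OnePoint ℝ)) (circlePt (y : OnePoint ℝ)) ≤ 2 * |x - y| := by
    refine (dist_cayley_le (by simp) (by simp)).trans_eq ?_
    rw [Complex.dist_of_im_eq (by simp), ofReal_re, ofReal_re, Real.dist_eq]
  have h2 : |x - y| ≤ 2 * rad a.1 := by
    have := abs_sub_le x (center a) y
    rw [abs_sub_comm (center a)] at this
    linarith
  have := Real.exp_pos (displacement g)
  nlinarith

lemma one_le_mul_of_visualDist_le {a : Letter} {x ρ : ℝ} (hx : |x - center a| ≤ rad a.1)
    (h : visualDist OnePoint.infty (x : OnePoint ℝ) ≤ ρ) : 1 ≤ ρ * (2 * a.1 + 3) := by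
  rw [visualDist_infty_coe] at h
  have h0 : 0 < √(x ^ 2 + 1) := by positivity
  rw [div_le_iff₀ h0] at h
  have h1 : |x| ≤ 2 * a.1 + 2 := by
    have := abs_sub_abs_le_abs_sub x (center a)
    rw [abs_of_nonneg (center_nonneg a)] at this
    linarith [center_le a, rad_le a.1]
  have h2 : √(x ^ 2 + 1) ≤ 2 * a.1 + 3 := by
    refine Real.sqrt_le_iff.2 ⟨by positivity, ?_⟩
    nlinarith [abs_nonneg x, sq_abs x]
  have hρ : 0 < ρ := by
    by_contra! hρ
    nlinarith
  nlinarith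

/-- Exponential decay of the radii beats any polynomial weight; both main estimates rest on this. -/
lemma tsum_pow_mul_rad_lt_top {t : ℝ} (ht : 0 < t) (p : ℕ) (C : ℝ) :
    ∑' a : Letter, ENNReal.ofReal (C * ((2 * a.1 + 3) ^ p * rad a.1 ^ t)) < ∞ := by
  have hsum : Summable fun n : ℕ => C * ((2 * (n : ℝ) + 3) ^ p * rad n ^ t) := by
    refine Summable.mul_left _ ?_
    set q : ℝ := (1 / 2) ^ t with hq
    have hq0 : 0 < q := by positivity
    have hq1 : q < 1 := Real.rpow_lt_one (by norm_num) (by norm_num) ht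
    have h1 : Summable fun n : ℕ => ((n + 1 : ℕ) : ℝ) ^ p * q ^ (n + 1) :=
      (summable_nat_add_iff (f := fun n : ℕ => (n : ℝ) ^ p * q ^ n) 1).2 (summable_pow_mul_geometric_of_norm_lt_one p
        (by rwa [Real.norm_of_nonneg hq0.le]))
    refine Summable.of_nonneg_of_le (fun n => ?_) (fun n => ?_)
      (h1.mul_left (3 ^ p * (1 / 8) ^ t * q⁻¹))
    · have := rad_pos n
      positivity
    · have e : rad n ^ t = q ^ n * (1 / 8) ^ t := by
        rw [rad, div_eq_mul_one_div, Real.mul_rpow (by positivity) (by norm_num), hq,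
          ← Real.rpow_natCast, ← Real.rpow_natCast, ← Real.rpow_mul (by norm_num),
          ← Real.rpow_mul (by norm_num), mul_comm t]
      have e2 : 3 ^ p * (1 / 8 : ℝ) ^ t * q⁻¹ * (((n + 1 : ℕ) : ℝ) ^ p * q ^ (n + 1)) =
          (3 * (n + 1 : ℝ)) ^ p * (q ^ n * (1 / 8) ^ t) := by
        push_cast
        rw [mul_pow, pow_succ]
        field_simp
      rw [e, e2]
      gcongr
      linarith
  rw [ENNReal.tsum_prod']
  simp only [tsum_fintype, Fintype.sum_bool]
  rw [ENNReal.tsum_add]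
  exact ENNReal.add_lt_top.2 ⟨hsum.tsum_ofReal_lt_top, hsum.tsum_ofReal_lt_top⟩

/-! ### The content near the point at infinity -/

lemma hausdorffContent_le_tsum {ι : Type*} [Countable ι] [Infinite ι] (s : ℝ) (S : Set (OnePoint ℝ))
    (A : ι → Set (OnePoint ℝ)) (h : S ⊆ ⋃ i, A i) :
    hausdorffContent s S ≤ ∑' i, ⨆ _ : (A i).Nonempty, visualDiam (A i) ^ s := by
  obtain ⟨_⟩ := nonempty_denumerable ι
  rw [← (Denumerable.eqv ι).symm.tsum_eq]
  refine iInf₂_le (fun n => A ((Denumerable.eqv ι).symm n)) (h.trans ?_)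
  exact (Equiv.iSup_comp (Denumerable.eqv ι).symm (g := A)).ge

lemma tsum_option {α : Type*} (f : Option α → ℝ≥0∞) :
    ∑' i, f i = f none + ∑' a, f (some a) := by
  rw [← (Equiv.optionEquivSumPUnit.{0} α).symm.tsum_eq,
    Summable.tsum_sum ENNReal.summable ENNReal.summable]
  simp [add_comm]

lemma localContent_le (σ : ℝ) {s r : ℝ} (hs : 0 < s) (hr : 0 < r) (M : ℕ) :
    localContent schottky OnePoint.infty σ s r ≤ ENNReal.ofReal r ^ M *
      ∑' a : Letter, ENNReal.ofReal (16 ^ s * ((2 * a.1 + 3) ^ M * rad a.1 ^ s)) := by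
  classical
  -- Intervals too far from infinity are replaced by the empty set; the point infinity itself has
  -- diameter `0` and costs nothing as `s > 0`.
  let A : Option Letter → Set (OnePoint ℝ) := fun i =>
    i.elim {OnePoint.infty} fun a => {η | η ∈ boundaryInterval a ∧ 1 ≤ r * (2 * a.1 + 3)}
  have hcover : {η | visualDist OnePoint.infty η ≤ r} ∩ radialLimitSetOf schottky σ ⊆
      ⋃ i, A i := by
    rintro η ⟨h1, h2⟩
    rw [Set.mem_iUnion]
    induction η using OnePoint.rec with
    | infty => exact ⟨none, rfl⟩
    | coe x =>
      obtain ⟨a, ha⟩ := exists_mem_boundaryInterval (radialLimitSetOf_subset _ _ h2)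
      refine ⟨some a, ha, ?_⟩
      obtain ⟨y, hy, hya⟩ := ha
      obtain rfl : x = y := OnePoint.coe_injective hy
      exact one_le_mul_of_visualDist_le hya h1
  refine (hausdorffContent_le_tsum s _ A hcover).trans ?_
  rw [← ENNReal.tsum_mul_left, tsum_option]
  have h0 : ⨆ _ : (A none).Nonempty, visualDiam (A none) ^ s = 0 := by
    simp [A, visualDiam, hs]
  rw [h0, zero_add]
  refine ENNReal.tsum_le_tsum fun a => iSup_le ?_
  rintro ⟨_, -, ha⟩
  have hrad := rad_pos a.1
  have hdiam : visualDiam (A (some a)) ≤ ENNReal.ofReal (16 * rad a.1) := by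
    have h := ediam_image_boundaryInterval_le 1 a
    have h1 : displacement 1 = 0 := by simp [displacement]
    simp only [h1, Real.exp_zero, one_mul] at h
    refine (ENNReal.div_le_of_le_mul ?_)
    refine le_trans (Metric.ediam_mono (Set.image_mono ?_)) (h.trans ?_)
    · exact fun η hη => ⟨η, hη.1, bdryAct_one η⟩
    · exact le_mul_of_one_le_right' (by norm_num)
  calc visualDiam (A (some a)) ^ s ≤ ENNReal.ofReal (16 * rad a.1) ^ s := by gcongr
    _ = ENNReal.ofReal (16 ^ s * rad a.1 ^ s) := by
        rw [ENNReal.ofReal_rpow_of_nonneg (by positivity) hs.le,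
          Real.mul_rpow (by norm_num) hrad.le]
    _ ≤ ENNReal.ofReal (r ^ M * (16 ^ s * ((2 * a.1 + 3) ^ M * rad a.1 ^ s))) := by
        refine ENNReal.ofReal_le_ofReal ?_
        -- The factor `(r * (2n + 3)) ^ M ≥ 1` trades a polynomial weight for a power of `r`.
        have h1 := one_le_pow₀ ha (n := M)
        have h2 : 0 ≤ 16 ^ s * rad a.1 ^ s := by positivity
        rw [mul_pow] at h1
        nlinarith [mul_le_mul_of_nonneg_right h1 h2]
    _ = _ := by rw [ENNReal.ofReal_mul (by positivity), ENNReal.ofReal_pow hr.le]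

lemma eventually_localContent_le (σ : ℝ) {s : ℝ} (hs : 0 < s) (M : ℕ) :
    ∀ᶠ r in 𝓝[>] (0 : ℝ),
      localContent schottky OnePoint.infty σ s r ≤ ENNReal.ofReal r ^ M := by
  -- One extra power of `r` absorbs the constant.
  set C := ∑' a : Letter, ENNReal.ofReal (16 ^ s * ((2 * a.1 + 3) ^ (M + 1) * rad a.1 ^ s))
  have hC : C ≠ ∞ := (tsum_pow_mul_rad_lt_top hs (M + 1) (16 ^ s)).ne
  have hlim : Tendsto (fun r : ℝ => ENNReal.ofReal r * C) (𝓝[>] 0) (𝓝 0) := by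
    have h : Tendsto (fun r : ℝ => ENNReal.ofReal r) (𝓝[>] 0) (𝓝 0) := by
      have := (ENNReal.continuous_ofReal.tendsto 0).mono_left (nhdsWithin_le_nhds (s := Set.Ioi 0))
      simpa using this
    simpa using ENNReal.Tendsto.mul_const h (Or.inr hC)
  filter_upwards [hlim.eventually (gt_mem_nhds one_pos), self_mem_nhdsWithin] with r h hr
  refine (localContent_le σ hs hr (M + 1)).trans ?_
  rw [pow_succ, mul_assoc]
  exact mul_le_of_le_one_right' h.le

lemma localDimension_eq_top {s : ℝ} (hs : 0 < s) :
    localDimension schottky OnePoint.infty s = ⊤ := by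
  have key : ∀ σ : ℝ, Filter.liminf (fun r : ℝ =>
      ENNReal.log (localContent schottky OnePoint.infty σ s r) / ((Real.log r : ℝ) : EReal))
      (𝓝[>] 0) = ⊤ := by
    intro σ
    refine Tendsto.liminf_eq (EReal.tendsto_nhds_top_iff_real.2 fun x => ?_)
    obtain ⟨M, hM⟩ := exists_nat_gt x
    filter_upwards [eventually_localContent_le σ hs M,
      Ioo_mem_nhdsGT (zero_lt_one : (0 : ℝ) < 1)] with r h hr
    have hlog : Real.log r < 0 := Real.log_neg hr.1 hr.2
    have h1 : ENNReal.log (localContent schottky OnePoint.infty σ s r) ≤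
        ((M * Real.log r : ℝ) : EReal) := by
      refine (ENNReal.log_monotone h).trans_eq ?_
      rw [← ENNReal.ofReal_pow hr.1.le, ENNReal.log_ofReal_of_pos (pow_pos hr.1 _), Real.log_pow]
    refine lt_of_lt_of_le ?_ (EReal.div_le_div_right_of_nonpos
      (by exact_mod_cast hlog.le) h1)
    rw [← EReal.coe_div, mul_div_cancel_right₀ _ hlog.ne]
    exact_mod_cast hM
  simp [localDimension, key]

/-! ### Very well approximable points -/

open MeasureTheory in
/-- The Borel-Cantelli lemma for the Hausdorff measure. -/
lemma hausdorffMeasure_limsup_eq_zero {X ι : Type*} [EMetricSpace X] [MeasurableSpace X]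
    [BorelSpace X] [Countable ι] {t : ℝ} (ht : 0 < t) (E : ι → Set X)
    (h : ∑' i, Metric.ediam (E i) ^ t ≠ ∞) :
    Measure.hausdorffMeasure t {x | {i | x ∈ E i}.Infinite} = 0 := by
  classical
  set tail : Finset ι → ℝ≥0∞ := fun F => ∑' i : {i // i ∉ F}, Metric.ediam (E i) ^ t
  have htail : Tendsto tail atTop (𝓝 0) := ENNReal.tendsto_tsum_compl_atTop_zero h
  -- Each diameter in a tail is at most the `t`-th root of the tail sum, so the covers become
  -- arbitrarily fine.
  have hroot : Tendsto (fun F => tail F ^ t⁻¹) atTop (𝓝 0) := by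
    have := (ENNReal.continuous_rpow_const (y := t⁻¹)).tendsto 0 |>.comp htail
    simpa [ENNReal.zero_rpow_of_pos (inv_pos.2 ht)] using! this
  have := Measure.hausdorffMeasure_le_liminf_tsum t {x | {i | x ∈ E i}.Infinite} _ hroot
    (fun F (i : {i // i ∉ F}) => E i)
    (Eventually.of_forall fun F i => by
      rw [ENNReal.le_rpow_inv_iff ht]
      exact ENNReal.le_tsum i)
    (Eventually.of_forall fun F x hx => by
      obtain ⟨i, hi, hiF⟩ := hx.exists_notMem_finset F
      exact Set.mem_iUnion.2 ⟨⟨i, hiF⟩, hi⟩)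
  rw [htail.liminf_eq] at this
  exact le_antisymm this bot_le

/-- The points that are not in the orbit of infinity and are approximated by it with exponent
`1 + c`. -/
def approximable (c : ℝ) : Set (OnePoint ℝ) :=
  {η | η ∈ limitSet schottky ∧ (∀ g ∈ schottky, bdryAct g OnePoint.infty ≠ η) ∧
    {g : schottky | visualDist (bdryAct g OnePoint.infty) η ≤
      Real.exp (-((1 + c) * displacement g))}.Infinite}

open MeasureTheory in
lemma hausdorffMeasure_approximable {c : ℝ} (hc : 0 < c) {t : ℝ} (ht : 0 < t) :
    Measure.hausdorffMeasure t (circlePt '' approximable c) = 0 := by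
  let E : schottky × Letter → Set ℂ := fun i =>
    {z | z ∈ circlePt '' (bdryAct i.1 '' boundaryInterval i.2) ∧
      Real.exp (c * displacement i.1) ≤ 4 * (2 * i.2.1 + 3)}
  -- With this `p`, nonemptiness of `E (g, a)` bounds `exp ((t + 1) d)` by a polynomial in the index
  -- of `a`. That pays for the distortion `exp (t d)` and leaves `exp (-d)`, so the double sum
  -- factors into the Poincaré series and a sum over letters.
  obtain ⟨p, hp⟩ := exists_nat_ge ((t + 1) / c)
  have hE : ∑' i, Metric.ediam (E i) ^ t ≠ ∞ := by
    have hle : ∀ i, Metric.ediam (E i) ^ t ≤ ENNReal.ofReal (Real.exp (-displacement i.1)) *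
        ENNReal.ofReal (16 ^ t * 4 ^ p * ((2 * i.2.1 + 3) ^ p * rad i.2.1 ^ t)) := by
      rintro ⟨g, a⟩
      have hrad := rad_pos a.1
      rcases Set.eq_empty_or_nonempty (E (g, a)) with h | ⟨z, hz⟩
      · rw [h]
        simp [ht]
      have h1 : Metric.ediam (E (g, a)) ≤
          ENNReal.ofReal (16 * (Real.exp (displacement g) * rad a.1)) :=
        (Metric.ediam_mono fun _ h => h.1).trans (ediam_image_boundaryInterval_le g a)
      have h2 : Real.exp ((t + 1) * displacement g) ≤ (4 * (2 * a.1 + 3)) ^ p := by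
        have h3 : (t + 1) * displacement g ≤ p * (c * displacement g) := by
          rw [div_le_iff₀ hc] at hp
          nlinarith [displacement_nonneg (g : SL(2, ℝ))]
        refine (Real.exp_le_exp.2 h3).trans ?_
        rw [Real.exp_nat_mul]
        exact pow_le_pow_left₀ (Real.exp_pos _).le hz.2 p
      calc Metric.ediam (E (g, a)) ^ t
          ≤ ENNReal.ofReal (16 * (Real.exp (displacement g) * rad a.1)) ^ t := by gcongr
        _ = ENNReal.ofReal (16 ^ t * (Real.exp (t * displacement g) * rad a.1 ^ t)) := by
            rw [ENNReal.ofReal_rpow_of_nonneg (by positivity) ht.le,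
              Real.mul_rpow (by norm_num) (by positivity), Real.mul_rpow (by positivity) hrad.le,
              ← Real.exp_mul, mul_comm (displacement g)]
        _ ≤ ENNReal.ofReal (Real.exp (-displacement g) *
              (16 ^ t * 4 ^ p * ((2 * a.1 + 3) ^ p * rad a.1 ^ t))) := by
            refine ENNReal.ofReal_le_ofReal ?_
            have e : Real.exp (t * displacement g) =
                Real.exp (-displacement g) * Real.exp ((t + 1) * displacement g) := by
              rw [← Real.exp_add]
              ring_nf
            rw [e]
            rw [mul_pow] at h2
            calc _ = Real.exp (-displacement g) * (16 ^ t * rad a.1 ^ t) *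
                  Real.exp ((t + 1) * displacement g) := by ring
              _ ≤ Real.exp (-displacement g) * (16 ^ t * rad a.1 ^ t) *
                  (4 ^ p * (2 * a.1 + 3) ^ p) := by gcongr
              _ = _ := by ring
        _ = _ := ENNReal.ofReal_mul (Real.exp_pos _).le
    refine ne_top_of_le_ne_top ?_ (ENNReal.tsum_le_tsum hle)
    rw [ENNReal.tsum_prod']
    simp only [ENNReal.tsum_mul_left, ENNReal.tsum_mul_right]
    exact ENNReal.mul_ne_top tsum_exp_neg_displacement_lt_top.ne
      (tsum_pow_mul_rad_lt_top ht p _).ne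
  refine measure_mono_null ?_ (hausdorffMeasure_limsup_eq_zero ht E hE)
  rintro _ ⟨η, ⟨hη, horb, hinf⟩, rfl⟩
  -- It suffices to find one letter for each approximating `g`: distinct `g` give distinct pairs.
  refine Set.Infinite.of_image Prod.fst (hinf.mono fun g hg => ?_)
  have hinv := inv_mem g.2
  have hne : bdryAct (g : SL(2, ℝ))⁻¹ η ≠ OnePoint.infty := by
    intro h
    refine horb g g.2 ?_
    rw [← h, bdryAct_bdryAct_inv]
  have hmem := bdryAct_mem_limitSet hinv hη
  obtain ⟨x, hx⟩ := OnePoint.ne_infty_iff_exists.1 hne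
  rw [← hx] at hmem
  obtain ⟨a, y, hy, ha⟩ := exists_mem_boundaryInterval hmem
  obtain rfl : x = y := OnePoint.coe_injective hy
  have hdist : visualDist OnePoint.infty (x : OnePoint ℝ) ≤
      4 * Real.exp (-(c * displacement g)) := by
    have h1 := dist_circlePt_bdryAct_le (g : SL(2, ℝ))⁻¹ (bdryAct g OnePoint.infty) η
    rw [bdryAct_inv_bdryAct, ← hx, displacement_inv] at h1
    have hg : dist (circlePt (bdryAct g OnePoint.infty)) (circlePt η) / 2 ≤ _ := hg
    have e : Real.exp (-(c * displacement g)) =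
        Real.exp (displacement g) * Real.exp (-((1 + c) * displacement g)) := by
      rw [← Real.exp_add]
      ring_nf
    rw [visualDist, e]
    nlinarith [Real.exp_pos (displacement (g : SL(2, ℝ)))]
  have hone := one_le_mul_of_visualDist_le ha hdist
  refine ⟨(g, a), ⟨⟨η, ⟨x, ⟨x, rfl, ha⟩, ?_⟩, rfl⟩, ?_⟩, rfl⟩
  · rw [hx, bdryAct_bdryAct_inv]
  · rw [Real.exp_neg, mul_right_comm, ← div_eq_mul_inv, le_div_iff₀ (Real.exp_pos _), one_mul]
      at hone
    exact hone

/-- On a finite set `f` would be bounded. -/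
lemma infinite_of_frequently_comap_atTop {α : Type*} {f : α → ℝ} {P : α → Prop}
    (h : ∃ᶠ x in comap f atTop, P x) : {x | P x}.Infinite := by
  intro hfin
  obtain ⟨R, hR⟩ := (hfin.image f).bddAbove
  have hev : ∀ᶠ x in comap f atTop, R < f x := tendsto_comap.eventually_gt_atTop R
  obtain ⟨x, hx, hx'⟩ := (h.and_eventually hev).exists
  exact absurd (hR ⟨x, hx, rfl⟩) (not_le.2 hx')

/-- The margins `1 / (k + 1)` make the very well approximable set a countable union, which Hausdorff
dimension respects. -/
lemma exists_infinite_of_one_lt_approxExponent {G : Subgroup SL(2, ℝ)} {ξ η : OnePoint ℝ}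
    (h : 1 < approxExponent G ξ η) : ∃ k : ℕ, {g : G | visualDist (bdryAct g ξ) η ≤
      Real.exp (-((1 + 1 / (k + 1)) * displacement g))}.Infinite := by
  obtain ⟨τ, h1, h2⟩ := EReal.lt_iff_exists_real_btwn.1 h
  have h1 : 0 < τ - 1 := sub_pos.2 (by exact_mod_cast h1)
  obtain ⟨k, hk⟩ := exists_nat_one_div_lt h1
  refine ⟨k, infinite_of_frequently_comap_atTop (f := fun g : G => displacement g) ?_⟩
  have hev : ∀ᶠ g : G in comap (fun g : G => displacement g) atTop, 0 < displacement g :=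
    tendsto_comap.eventually_gt_atTop 0
  refine ((frequently_lt_of_lt_limsup (by isBoundedDefault) h2).and_eventually hev).mono ?_
  rintro g ⟨hg, hpos⟩
  rw [EReal.lt_div_iff (by exact_mod_cast hpos) (EReal.coe_ne_top _), EReal.lt_neg_comm] at hg
  have hlt : visualDist (bdryAct g ξ) η < Real.exp (-(τ * displacement g)) := by
    by_contra! hle
    refine absurd (ENNReal.log_monotone (ENNReal.ofReal_le_ofReal hle)) (not_le.2 ?_)
    rw [ENNReal.log_ofReal_of_pos (Real.exp_pos _), Real.log_exp]
    exact_mod_cast hg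
  refine hlt.le.trans (Real.exp_le_exp.2 ?_)
  nlinarith

lemma hausdorffDim_veryWellApproximable :
    hausdorffDim (veryWellApproximable schottky OnePoint.infty) = 0 := by
  have hsub : circlePt '' veryWellApproximable schottky OnePoint.infty ⊆
      Set.range (fun g : schottky => circlePt (bdryAct g OnePoint.infty)) ∪
        ⋃ k : ℕ, circlePt '' approximable (1 / (k + 1)) := by
    rintro _ ⟨η, ⟨hη, hω⟩, rfl⟩
    by_cases horb : ∃ g ∈ schottky, bdryAct g OnePoint.infty = η
    · obtain ⟨g, hg, rfl⟩ := horb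
      exact Or.inl ⟨⟨g, hg⟩, rfl⟩
    · push Not at horb
      obtain ⟨k, hk⟩ := exists_infinite_of_one_lt_approxExponent hω
      exact Or.inr (Set.mem_iUnion.2 ⟨k, η, ⟨radialLimitSet_subset _ hη, horb, hk⟩, rfl⟩)
  have hzero : ∀ k : ℕ, dimH (circlePt '' approximable (1 / (k + 1))) = 0 := by
    intro k
    refine le_antisymm (ENNReal.le_of_forall_pos_le_add fun ε hε _ => ?_) bot_le
    rw [zero_add]
    refine dimH_le_of_hausdorffMeasure_ne_top ?_
    rw [hausdorffMeasure_approximable (by positivity) (by exact_mod_cast hε)]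
    exact ENNReal.zero_ne_top
  refine le_antisymm ((dimH_mono hsub).trans ?_) bot_le
  rw [dimH_union, dimH_iUnion, dimH_countable (Set.countable_range _)]
  simp only [hzero, ciSup_const, max_self, le_refl]

end FuchsianApprox
end

theorem mainTheorem12 :
    ∃ (G : Subgroup SL(2, ℝ)) (ξ : OnePoint ℝ),
      DiscreteTopology G ∧
      FuchsianApprox.Nonelementary G ∧
      FuchsianApprox.IsInfiniteSchottky G ∧
      ¬ G.FG ∧
      ξ ∈ FuchsianApprox.limitSet G ∧
      FuchsianApprox.hausdorffDim (FuchsianApprox.veryWellApproximable G ξ) = 0 ∧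
      ∀ s : ℝ, 0 < s → ENNReal.ofReal s < FuchsianApprox.poincareExponent G →
        FuchsianApprox.localDimension G ξ s = ⊤ :=
  ⟨FuchsianApprox.schottky, OnePoint.infty, FuchsianApprox.discreteTopology_schottky,
    FuchsianApprox.nonelementary_schottky, FuchsianApprox.isInfiniteSchottky_schottky,
    FuchsianApprox.not_fg_schottky, FuchsianApprox.infty_mem_limitSet,
    FuchsianApprox.hausdorffDim_veryWellApproximable,
    fun _ hs _ => FuchsianApprox.localDimension_eq_top hs⟩
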